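/- Let $n,m\ge 1$. A weight on $\mathbb R^n$ is a Lebesgue measurable function $w$ with $0<w(x)<\infty$ for almost every $x$ (weights are not assumed to be locally integrable). Below, $Q$ ranges over all cubes in $\mathbb R^n$ with sides parallel to the coordinate axes, $\frac{1}{|Q|}\int_Q f\,dx\in[0,\infty]$ denotes an average, and $q'=\frac{q}{q-1}$ for $1<q<\infty$. For $1<q<\infty$, a weight $w$ belongs to $A_q$ if $$[w]_{A_q}=\sup_Q\Big(\frac1{|Q|}\int_Q w\,dx\Big)\Big(\frac1{|Q|}\int_Q w^{1-q'}\,dx\Big)^{q-1}<\infty,$$ and $A_\infty=\bigcup_{1<q<\infty}A_q$. Let $1<p_1,\dots,p_m<\infty$, let $p$ be defined by $\frac1p=\sum_{i=1}^m\frac1{p_i}$, and let $\vec w=(w_1,\dots,w_m)$ be a vector of weights. Put $w=\prod_{i=1}^m w_i^{p/p_i}$ and $\sigma_i=w_i^{1-p_i'}$ for $1\le i\le m$. One says that $\vec w\in A_{\vec p}$ if $$[\vec w]_{A_{\vec p}}=\sup_Q\Big(\frac1{|Q|}\int_Q w\,dx\Big)^{1/p}\prod_{i=1}^m\Big(\frac1{|Q|}\int_Q\sigma_i\,dx\Big)^{1/p_i'}<\infty.$$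 Theorem. $\vec w\in A_{\vec p}$ if and only if $w,\sigma_1,\dots,\sigma_m\in A_\infty$. -/

import Mathlib

open MeasureTheory
open scoped ENNReal

/-- A weight on `ℝⁿ`: a Lebesgue measurable function with values in `(0, ∞)` almost everywhere
(not assumed locally integrable). -/
def IsWeight {n : ℕ} (w : (Fin n → ℝ) → ℝ≥0∞) : Prop :=
  AEMeasurable w volume ∧ ∀ᵐ x ∂(volume : Measure (Fin n → ℝ)), 0 < w x ∧ w x < ∞

/-- The closed cube with lower corner `a` and side length `ℓ`, with sides parallel to the
coordinate axes. -/
def cube {n : ℕ} (a : Fin n → ℝ) (ℓ : ℝ) : Set (Fin n → ℝ) :=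
  Set.Icc a (fun i => a i + ℓ)

/-- The Muckenhoupt characteristic `[w]_{A_p}`, an element of `[0, ∞]`. For a weight `w` both
averages are positive, so that the product `0 * ∞` does not occur. -/
noncomputable def apConst {n : ℕ} (p : ℝ) (w : (Fin n → ℝ) → ℝ≥0∞) : ℝ≥0∞ :=
  ⨆ (a : Fin n → ℝ) (ℓ : ℝ) (_ : 0 < ℓ),
    (⨍⁻ x in cube a ℓ, w x ∂volume) *
      (⨍⁻ x in cube a ℓ, w x ^ (1 - p.conjExponent) ∂volume) ^ (p - 1)

/-- The Muckenhoupt class `A_p`, for `1 < p < ∞`. -/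
def MemAp {n : ℕ} (p : ℝ) (w : (Fin n → ℝ) → ℝ≥0∞) : Prop :=
  IsWeight w ∧ apConst p w < ∞

/-- The class `A_∞`, the union of the classes `A_p` over `1 < p < ∞`. -/
def MemAInfty {n : ℕ} (w : (Fin n → ℝ) → ℝ≥0∞) : Prop :=
  ∃ p : ℝ, 1 < p ∧ MemAp p w

/-- The product weight `w = ∏ᵢ wᵢ ^ (p / pᵢ)`. -/
noncomputable def prodWeight {n m : ℕ} (p : ℝ) (ps : Fin m → ℝ)
    (w : Fin m → (Fin n → ℝ) → ℝ≥0∞) : (Fin n → ℝ) → ℝ≥0∞ :=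
  fun x => ∏ i, w i x ^ (p / ps i)

/-- The dual weight `σ = w ^ (1 - p')` of a weight `w` with respect to the exponent `p`. -/
noncomputable def dualWeight {n : ℕ} (p : ℝ) (w : (Fin n → ℝ) → ℝ≥0∞) :
    (Fin n → ℝ) → ℝ≥0∞ :=
  fun x => w x ^ (1 - p.conjExponent)

/-- The multilinear characteristic of a vector of weights, for the exponents `ps` and `p` with
`1 / p = ∑ᵢ 1 / pᵢ`. -/
noncomputable def multApConst {n m : ℕ} (p : ℝ) (ps : Fin m → ℝ)
    (w : Fin m → (Fin n → ℝ) → ℝ≥0∞) : ℝ≥0∞ :=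
  ⨆ (a : Fin n → ℝ) (ℓ : ℝ) (_ : 0 < ℓ),
    (⨍⁻ x in cube a ℓ, prodWeight p ps w x ∂volume) ^ (1 / p) *
      ∏ i, (⨍⁻ x in cube a ℓ, dualWeight (ps i) (w i) x ∂volume) ^ (1 / (ps i).conjExponent)

/-- The multilinear class of vector weights attached to the exponents `ps` and `p`. -/
def MemMultAp {n m : ℕ} (p : ℝ) (ps : Fin m → ℝ)
    (w : Fin m → (Fin n → ℝ) → ℝ≥0∞) : Prop :=
  (∀ i, IsWeight (w i)) ∧ multApConst p ps w < ∞

section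

variable {n : ℕ}

/-! The weights w, σ₁, …, σₘ with exponents θ = 1/p, 1/p₁', …, 1/pₘ' play symmetric roles: they
satisfy the single relation ∏ fₖ ^ θₖ = 1 almost everywhere, and the multilinear characteristic is
their `jointConst`. Only this relation and Hölder are used. If the joint constant is finite, the
relation writes a negative power of fⱼ as a product of the other weights; Hölder bounds its average
by theirs, which is an A_q condition on fⱼ (`apConst_le_jointConst_rpow`). Conversely, if each fₖ is
in A_{qₖ}, Hölder for the constant 1, written as a product of powers of the dual weights, bounds a
product of dual averages below by 1. Inserting that product turns the joint expression into a
product of A_{qₖ} expressions (`jointConst_le_prod_apConst_rpow`). -/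

lemma one_sub_conjExponent {p : ℝ} (hp : 1 < p) : 1 - p.conjExponent = -(1 / (p - 1)) := by
  have : p - 1 ≠ 0 := by linarith
  unfold Real.conjExponent
  field_simp
  ring

lemma IsWeight.rpow {w : (Fin n → ℝ) → ℝ≥0∞} (hw : IsWeight w) (r : ℝ) :
    IsWeight fun x => w x ^ r := by
  refine ⟨hw.1.pow_const r, ?_⟩
  filter_upwards [hw.2] with x hx
  exact ⟨ENNReal.rpow_pos hx.1 hx.2.ne, (ENNReal.rpow_ne_top_of_ne_zero hx.1.ne' hx.2.ne).lt_top⟩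

lemma IsWeight.prod {ι : Type*} {s : Finset ι} {w : ι → (Fin n → ℝ) → ℝ≥0∞}
    (hw : ∀ i ∈ s, IsWeight (w i)) : IsWeight fun x => ∏ i ∈ s, w i x := by
  refine ⟨Finset.aemeasurable_fun_prod _ fun i hi => (hw i hi).1, ?_⟩
  have h : ∀ᵐ x ∂(volume : Measure (Fin n → ℝ)), ∀ i ∈ s, 0 < w i x ∧ w i x < ∞ :=
    (s.eventually_all).2 fun i hi => (hw i hi).2
  filter_upwards [h] with x hx
  exact ⟨pos_iff_ne_zero.2 (Finset.prod_ne_zero_iff.2 fun i hi => (hx i hi).1.ne'),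
    ENNReal.prod_lt_top fun i hi => (hx i hi).2⟩

lemma volume_cube_ne_zero (a : Fin n → ℝ) {ℓ : ℝ} (hℓ : 0 < ℓ) : volume (cube a ℓ) ≠ 0 := by
  simp [cube, Real.volume_Icc_pi, hℓ]

lemma volume_cube_ne_top (a : Fin n → ℝ) (ℓ : ℝ) : volume (cube a ℓ) ≠ ∞ := by
  simp [cube, Real.volume_Icc_pi]

/-- Hölder's inequality for averages of finitely many functions. -/
lemma laverage_prod_rpow_le {α ι : Type*} [MeasurableSpace α] {μ : Measure α} (s : Finset ι)
    {f : ι → α → ℝ≥0∞} (hf : ∀ i ∈ s, AEMeasurable (f i) μ) {θ : ι → ℝ}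
    (hθ : ∑ i ∈ s, θ i = 1) (hθ0 : ∀ i ∈ s, 0 ≤ θ i) :
    ⨍⁻ x, ∏ i ∈ s, f i x ^ θ i ∂μ ≤ ∏ i ∈ s, (⨍⁻ x, f i x ∂μ) ^ θ i :=
  ENNReal.lintegral_prod_norm_pow_le s (fun i hi => (hf i hi).smul_measure _) hθ hθ0

/-- The joint characteristic `sup_Q ∏ₖ (⨍_Q fₖ) ^ θₖ` of a finite family of functions. -/
noncomputable def jointConst {ι : Type*} [Fintype ι] (θ : ι → ℝ)
    (f : ι → (Fin n → ℝ) → ℝ≥0∞) : ℝ≥0∞ :=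
  ⨆ (a : Fin n → ℝ) (ℓ : ℝ) (_ : 0 < ℓ), ∏ k, (⨍⁻ x in cube a ℓ, f k x ∂volume) ^ θ k

variable {ι : Type*} [Fintype ι] {θ : ι → ℝ} {f : ι → (Fin n → ℝ) → ℝ≥0∞}

/-- If `∏ₖ fₖ ^ θₖ = 1`, then each `fⱼ` satisfies the Muckenhoupt condition with exponent
`1 + (∑_{k ≠ j} θₖ) / θⱼ` and characteristic controlled by the joint one. -/
lemma apConst_le_jointConst_rpow [DecidableEq ι] (hθ : ∀ k, 0 < θ k)
    (hf : ∀ k, IsWeight (f k)) (hprod : ∀ᵐ x, ∏ k, f k x ^ θ k = 1) (j : ι)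
    {T : ℝ} (hT : T = ∑ k ∈ Finset.univ.erase j, θ k) (hT0 : 0 < T) :
    apConst (1 + T / θ j) (f j) ≤ jointConst θ f ^ (1 / θ j) := by
  have hj := hθ j
  have hq : 1 < 1 + T / θ j := lt_add_of_pos_right _ (by positivity)
  refine iSup_le fun a => iSup_le fun ℓ => iSup_le fun hℓ => ?_
  -- For q = 1 + T / θⱼ the dual exponent 1 - q' is -θⱼ / T, which makes the Hölder exponents θₖ / T
  -- of the other weights sum to 1.
  have hdual : ⨍⁻ x in cube a ℓ, f j x ^ (1 - (1 + T / θ j).conjExponent) ∂volume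
      = ⨍⁻ x in cube a ℓ, ∏ k ∈ Finset.univ.erase j, f k x ^ (θ k / T) ∂volume := by
    refine laverage_congr (ae_restrict_of_ae ?_)
    filter_upwards [hprod] with x hx
    rw [← Finset.mul_prod_erase _ _ (Finset.mem_univ j), mul_comm] at hx
    have h := ENNReal.eq_inv_of_mul_eq_one_left hx
    calc f j x ^ (1 - (1 + T / θ j).conjExponent) = ((f j x ^ θ j)⁻¹) ^ (1 / T) := by
          rw [one_sub_conjExponent hq, add_sub_cancel_left, ← ENNReal.rpow_neg, ← ENNReal.rpow_mul]
          congr 1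
          field_simp
      _ = _ := by
          rw [← h, ← ENNReal.prod_rpow_of_nonneg (by positivity)]
          simp only [← ENNReal.rpow_mul, mul_one_div]
  have hholder := laverage_prod_rpow_le (μ := volume.restrict (cube a ℓ))
    (Finset.univ.erase j) (f := f) (θ := fun k => θ k / T)
    (fun k _ => (hf k).1.restrict)
    (by rw [← Finset.sum_div, ← hT, div_self hT0.ne'])
    (fun k _ => div_nonneg (hθ k).le hT0.le)
  rw [hdual]
  calc _ ≤ (⨍⁻ x in cube a ℓ, f j x ∂volume) * (∏ k ∈ Finset.univ.erase j,
          (⨍⁻ x in cube a ℓ, f k x ∂volume) ^ (θ k / T)) ^ (1 + T / θ j - 1) := by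
        gcongr
    _ = (∏ k, (⨍⁻ x in cube a ℓ, f k x ∂volume) ^ θ k) ^ (1 / θ j) := by
        rw [← ENNReal.prod_rpow_of_nonneg (by linarith),
          ← ENNReal.prod_rpow_of_nonneg (by positivity),
          ← Finset.mul_prod_erase _ _ (Finset.mem_univ j)]
        simp only [← ENNReal.rpow_mul]
        rw [mul_one_div_cancel hj.ne', ENNReal.rpow_one]
        congr 1
        refine Finset.prod_congr rfl fun k _ => ?_
        congr 1
        field_simp
        ring
    _ ≤ _ := by
        gcongr
        exact le_iSup_of_le a (le_iSup_of_le ℓ (le_iSup_of_le hℓ le_rfl))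

/-- If `∏ₖ fₖ ^ θₖ = 1`, then the joint characteristic is controlled by the Muckenhoupt
characteristics of the `fₖ`, for arbitrary exponents. -/
lemma jointConst_le_prod_apConst_rpow [Nonempty ι] (hθ : ∀ k, 0 < θ k)
    (hf : ∀ k, IsWeight (f k)) (hprod : ∀ᵐ x, ∏ k, f k x ^ θ k = 1)
    {q : ι → ℝ} (hq : ∀ k, 1 < q k) :
    jointConst θ f ≤ ∏ k, apConst (q k) (f k) ^ θ k := by
  refine iSup_le fun a => iSup_le fun ℓ => iSup_le fun hℓ => ?_
  have hpos : ∀ k, 0 < (q k - 1) * θ k := fun k => mul_pos (sub_pos.2 (hq k)) (hθ k)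
  -- S normalises the Hölder exponents. Since (1 - qₖ')(qₖ - 1) = -1, the product of dual weights
  -- becomes (∏ fₖ ^ θₖ) ^ (-1/S) = 1.
  obtain ⟨S, hS⟩ : ∃ S, S = ∑ k, (q k - 1) * θ k := ⟨_, rfl⟩
  have hS0 : 0 < S := hS ▸ Finset.sum_pos (fun k _ => hpos k) Finset.univ_nonempty
  have hholder := laverage_prod_rpow_le (μ := volume.restrict (cube a ℓ)) Finset.univ
    (f := fun k x => f k x ^ (1 - (q k).conjExponent)) (θ := fun k => (q k - 1) * θ k / S)
    (fun k _ => ((hf k).rpow _).1.restrict)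
    (by rw [← Finset.sum_div, ← hS, div_self hS0.ne'])
    (fun k _ => div_nonneg (hpos k).le hS0.le)
  have hone : ⨍⁻ x in cube a ℓ,
      ∏ k, (f k x ^ (1 - (q k).conjExponent)) ^ ((q k - 1) * θ k / S) ∂volume = 1 := by
    rw [← setLAverage_one (volume_cube_ne_zero a hℓ) (volume_cube_ne_top a ℓ)]
    refine laverage_congr (ae_restrict_of_ae ?_)
    filter_upwards [hprod, Filter.eventually_all.2 fun k => (hf k).2] with x hx hfin
    calc _ = ∏ k, (f k x ^ θ k) ^ (-(1 / S)) := by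
          refine Finset.prod_congr rfl fun k _ => ?_
          have : q k - 1 ≠ 0 := (sub_pos.2 (hq k)).ne'
          rw [one_sub_conjExponent (hq k), ← ENNReal.rpow_mul, ← ENNReal.rpow_mul]
          congr 1
          field_simp
      _ = 1 := by
          rw [ENNReal.prod_rpow_of_ne_top fun k _ =>
            ENNReal.rpow_ne_top_of_nonneg (hθ k).le (hfin k).2.ne, hx, ENNReal.one_rpow]
  have hdual : 1 ≤ ∏ k, (⨍⁻ x in cube a ℓ, f k x ^ (1 - (q k).conjExponent) ∂volume) ^
      ((q k - 1) * θ k) := by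
    calc (1 : ℝ≥0∞) = 1 ^ S := (ENNReal.one_rpow S).symm
      _ ≤ _ := ENNReal.rpow_le_rpow (hone ▸ hholder) hS0.le
      _ = _ := by
          rw [← ENNReal.prod_rpow_of_nonneg hS0.le]
          simp only [← ENNReal.rpow_mul, div_mul_cancel₀ _ hS0.ne']
  refine (le_mul_of_one_le_right' hdual).trans ?_
  rw [← Finset.prod_mul_distrib]
  refine Finset.prod_le_prod' fun k _ => ?_
  rw [ENNReal.rpow_mul, ← ENNReal.mul_rpow_of_nonneg _ _ (hθ k).le]
  refine ENNReal.rpow_le_rpow ?_ (hθ k).le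
  exact le_iSup_of_le a (le_iSup_of_le ℓ (le_iSup_of_le hℓ le_rfl))

/-- For at least two weights with `∏ₖ fₖ ^ θₖ = 1`, the joint characteristic is finite if and
only if every weight belongs to `A_∞`. -/
lemma jointConst_lt_top_iff [Nontrivial ι] (hθ : ∀ k, 0 < θ k)
    (hf : ∀ k, IsWeight (f k)) (hprod : ∀ᵐ x, ∏ k, f k x ^ θ k = 1) :
    jointConst θ f < ∞ ↔ ∀ k, MemAInfty (f k) := by
  classical
  constructor
  · intro h j
    -- A second index makes T positive, hence the exponent 1 + T / θⱼ exceeds 1.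
    obtain ⟨i, hi⟩ := exists_ne j
    have hT0 : 0 < ∑ k ∈ Finset.univ.erase j, θ k :=
      Finset.sum_pos (fun k _ => hθ k) ⟨i, Finset.mem_erase.2 ⟨hi, Finset.mem_univ i⟩⟩
    have hj := hθ j
    exact ⟨_, lt_add_of_pos_right 1 (div_pos hT0 hj), hf j,
      (apConst_le_jointConst_rpow hθ hf hprod j rfl hT0).trans_lt
        (ENNReal.rpow_lt_top_of_nonneg (by positivity) h.ne)⟩
  · intro h
    choose q hq hmem using h
    exact (jointConst_le_prod_apConst_rpow hθ hf hprod hq).trans_lt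
      (ENNReal.prod_lt_top fun k _ => ENNReal.rpow_lt_top_of_nonneg (hθ k).le (hmem k).2.ne)

end

theorem mainTheorem5 {n m : ℕ} (hm : 1 ≤ m) (ps : Fin m → ℝ) (hps : ∀ i, 1 < ps i)
    (p : ℝ) (hp : 1 / p = ∑ i, 1 / ps i)
    (w : Fin m → (Fin n → ℝ) → ℝ≥0∞) (hw : ∀ i, IsWeight (w i)) :
    MemMultAp p ps w ↔
      MemAInfty (prodWeight p ps w) ∧ ∀ i, MemAInfty (dualWeight (ps i) (w i)) := by
  have : Nonempty (Fin m) := ⟨⟨0, hm⟩⟩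
  have hps0 : ∀ i, 0 < ps i := fun i => one_pos.trans (hps i)
  have hp0 : 0 < p := one_div_pos.1 <|
    hp ▸ Finset.sum_pos (fun i _ => one_div_pos.2 (hps0 i)) Finset.univ_nonempty
  -- `none` indexes w and `some i` indexes σᵢ; as m ≥ 1, there are at least two indices.
  let θ : Option (Fin m) → ℝ := fun k => k.elim (1 / p) fun i => 1 / (ps i).conjExponent
  let f : Option (Fin m) → (Fin n → ℝ) → ℝ≥0∞ :=
    fun k => k.elim (prodWeight p ps w) fun i => dualWeight (ps i) (w i)
  have hθ : ∀ k, 0 < θ k := by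
    rintro (_ | i)
    · exact one_div_pos.2 hp0
    · exact one_div_pos.2 (div_pos (hps0 i) (sub_pos.2 (hps i)))
  have hf : ∀ k, IsWeight (f k) := by
    rintro (_ | i)
    · exact IsWeight.prod (s := Finset.univ) fun i _ => (hw i).rpow (p / ps i)
    · exact (hw i).rpow _
  have hprod : ∀ᵐ x, ∏ k, f k x ^ θ k = 1 := by
    filter_upwards [Filter.eventually_all.2 fun i => (hw i).2] with x hx
    simp only [Fintype.prod_option, f, θ, Option.elim_none, Option.elim_some, prodWeight,
      dualWeight]
    rw [← ENNReal.prod_rpow_of_nonneg (one_div_pos.2 hp0).le, ← Finset.prod_mul_distrib]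
    -- The total exponent of wᵢ is 1/pᵢ + (1 - pᵢ')/pᵢ' = 1/pᵢ + 1/pᵢ' - 1 = 0.
    refine Finset.prod_eq_one fun i _ => ?_
    have h1 : ps i - 1 ≠ 0 := (sub_pos.2 (hps i)).ne'
    have h2 : ps i ≠ 0 := (hps0 i).ne'
    rw [← ENNReal.rpow_mul, ← ENNReal.rpow_mul, ← ENNReal.rpow_add _ _ (hx i).1.ne' (hx i).2.ne]
    convert ENNReal.rpow_zero using 2
    rw [one_sub_conjExponent (hps i), Real.conjExponent]
    field_simp
    ring
  have hconst : multApConst p ps w = jointConst θ f := by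
    simp only [multApConst, jointConst, Fintype.prod_option, f, θ, Option.elim_none,
      Option.elim_some]
  rw [MemMultAp, hconst, jointConst_lt_top_iff hθ hf hprod, and_iff_right hw, Option.forall]
  rfl
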